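/- Let $n\ge 4$, let $P=\{p_1,\dots,p_n\}\subset\mathbb{CP}^1$ be a set of $n$ distinct points, and let $K_{\log}=K_{\mathbb{CP}^1}(P)$. Identify $\mathcal O(n-2)\cong K_{\log}$ by multiplication with the nowhere vanishing section $$\omega=\frac{x_0\,dx_1-x_1\,dx_0}{\prod_{i=1}^n \ell_i(x)}$$ of $K_{\log}\otimes\mathcal O(2-n)$, where $\ell_i$ is a nonzero linear form vanishing at $p_i$ (so $\omega$ has simple poles precisely at $P$; it is unique up to a nonzero scalar). Let $$V=\mathcal O(1)\oplus\mathcal O,\qquad L=\mathcal O(-1),\qquad E=V\oplus L,$$ and let $g_1\in H^0(\mathcal O(n-4))$, $g_2\in H^0(\mathcal O(n-3))$, $q\in H^0(\mathcal O(3))$ be such that $g_1,g_2$ have no common zero and $q(p_i)\ne0$ for all $i$. Let $\Phi\in H^0(\mathbb{CP}^1,\mathrm{End}(E)\otimes K_{\log})$ be the logarithmic Higgs field $$\Phi=\begin{pmatrix}0&\beta\\ \gamma&0\end{pmatrix},\qquad \gamma=(g_1,\,g_2)\,\omega: V\to L\otimes K_{\log},\qquad \beta=\begin{pmatrix}-q\,g_2\\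 q\,g_1\end{pmatrix}\omega: L\to V\otimes K_{\log}.$$ Then $F_1=\ker\gamma\subset V$ and $F_2=\ker\gamma\oplus L\subset E$ are $\Phi$-invariant saturated holomorphic subbundles of $E$, and they are the only proper nonzero ones. Moreover $\deg F_1=4-n$, $\deg F_2=3-n$ and $\deg E=0$. Consequently the Higgs bundle $(E,\Phi)$ is stable if $n\ge5$, and strictly semistable (semistable but not stable) if $n=4$. Here $(E,\Phi)$ is stable (respectively semistable) if $\deg F/\operatorname{rk}F<\deg E/\operatorname{rk}E$ (respectively $\le$) for every proper nonzero $\Phi$-invariant holomorphic subbundle $F\subset E$. -/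

import Mathlib

open scoped LinearAlgebra.Projectivization

noncomputable section

namespace NNoid

/-!
Throughout, the complex projective line is the quotient of the punctured plane `ℂ² ∖ {0}` by
`ℂˣ`, and everything on it is described equivariantly on `ℂ² ∖ {0}` (homogeneous coordinates).
The line bundle `O(d)` is `(ℂ² ∖ {0}) × ℂ` modulo `(x, c) ∼ (t x, t ^ d c)`, so that its sections
are the holomorphic functions `f` on cones in `ℂ² ∖ {0}` with `f (t x) = t ^ d f x`.
-/

/-- The Riemann sphere. -/
abbrev CP1 : Type := ℙ ℂ (Fin 2 → ℂ)

/-- The punctured plane, i.e. the set of homogeneous coordinate vectors. -/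
abbrev Cone : Type := {x : Fin 2 → ℂ // x ≠ 0}

/-- The point of the projective line with given homogeneous coordinates. -/
def Cone.point (x : Cone) : CP1 := Projectivization.mk ℂ x.1 x.2

/-- The scaling action of `ℂˣ` on the punctured plane. -/
def Cone.scale (t : ℂˣ) (x : Cone) : Cone :=
  ⟨(t : ℂ) • x.1, smul_ne_zero t.ne_zero x.2⟩

section Bundles

variable {ι : Type} [Fintype ι]

/-- The diagonal automorphism `diag (t ^ a i)`, which identifies the coordinates of the fibre of
`⨁ i, O(a i)` with respect to `x` with those with respect to `t x`. -/
def weightAct (a : ι → ℤ) (t : ℂˣ) : (ι → ℂ) →ₗ[ℂ] (ι → ℂ) :=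
  LinearMap.pi fun i => ((t : ℂ) ^ a i) • LinearMap.proj i

/-- A holomorphic subbundle of `⨁ i, O(a i)` over the projective line: a family of subspaces of
the fibres which is compatible with the change of homogeneous coordinates and has holomorphic
local frames of fixed length. (Having constant rank in the fibres, it is saturated:
the quotient is again a bundle.) -/
@[ext]
structure Subbundle (a : ι → ℤ) where
  /-- the rank -/
  rank : ℕ
  /-- the fibre at the point with homogeneous coordinates `x` -/
  fibre : Cone → Submodule ℂ (ι → ℂ)
  equivariant : ∀ (t : ℂˣ) (x : Cone), fibre (x.scale t) = (fibre x).map (weightAct a t)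
  exists_frame : ∀ x : Cone, ∃ (U : Set (Fin 2 → ℂ)) (s : Fin rank → (Fin 2 → ℂ) → (ι → ℂ)),
    IsOpen U ∧ x.1 ∈ U ∧ (∀ j, DifferentiableOn ℂ (s j) U) ∧
      ∀ y : Cone, y.1 ∈ U → LinearIndependent ℂ (fun j => s j y.1) ∧
        Submodule.span ℂ (Set.range fun j => s j y.1) = fibre y

/-- The subbundle is neither zero nor everything. -/
def Subbundle.IsProper {a : ι → ℤ} (F : Subbundle a) : Prop :=
  0 < F.rank ∧ F.rank < Fintype.card ι

/-- `det F ≅ O(d)`: there is a nowhere vanishing holomorphic section `ψ` of `(det F) ⊗ O(-d)`.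
The section is written in Plücker coordinates: `ψ x = b 0 ∧ b 1 ∧ ⋯` for a basis `b` of the fibre
of `F` at `x`, and the coordinate with multi-index `I` is the minor of `b` with rows `I`, a section
of `O(∑ j, a (I j) - d)`. -/
def Subbundle.HasDegree {a : ι → ℤ} (F : Subbundle a) (d : ℤ) : Prop :=
  ∃ ψ : (Fin 2 → ℂ) → (Fin F.rank → ι) → ℂ,
    (∀ I, DifferentiableOn ℂ (fun x => ψ x I) {0}ᶜ) ∧
    (∀ (t : ℂˣ) (x : Cone) (I : Fin F.rank → ι),
      ψ (x.scale t).1 I = (t : ℂ) ^ ((∑ j, a (I j)) - d) * ψ x.1 I) ∧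
    ∀ x : Cone, ∃ b : Fin F.rank → (ι → ℂ), LinearIndependent ℂ b ∧
      Submodule.span ℂ (Set.range b) = F.fibre x ∧
      ∀ I : Fin F.rank → ι, ψ x.1 I = Matrix.det (Matrix.of fun i j => b j (I i))

open Classical in
/-- The degree of a subbundle: the integer `d` with `det F ≅ O(d)`. (It exists and is unique since
the Picard group of the projective line is freely generated by `O(1)`.) -/
def Subbundle.degree {a : ι → ℤ} (F : Subbundle a) : ℤ :=
  if h : ∃ d, F.HasDegree d then h.choose else 0

/-- The slope of a subbundle. -/
def Subbundle.slope {a : ι → ℤ} (F : Subbundle a) : ℚ := F.degree / F.rank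

/-- The degree of `⨁ i, O(a i)`. -/
def totalDegree (a : ι → ℤ) : ℤ := ∑ i, a i

/-- The slope of `⨁ i, O(a i)`. -/
def totalSlope (a : ι → ℤ) : ℚ := totalDegree a / Fintype.card ι

/-- The determinant of two vectors in the plane. For fixed `p` it is a linear form in the second
vector vanishing exactly along the line of `p`; as a form in `v` at the point `x`, it is the
`O(2)`-valued nowhere vanishing 1-form `x₀ dx₁ - x₁ dx₀`. -/
def area (x v : Fin 2 → ℂ) : ℂ := x 0 * v 1 - x 1 * v 0

/-- A homogeneous equation of the divisor `P`. -/
def divisorForm (P : Finset CP1) (x : Fin 2 → ℂ) : ℂ := ∏ p ∈ P, area p.rep x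

/-- A logarithmic Higgs field on `E = ⨁ i, O(a i)` over the projective line with divisor `P`: an
`End E`-valued holomorphic 1-form on the complement of `P` with at most simple poles along `P`,
i.e. a global section of `End E ⊗ K(P)`. The form is pulled back to the punctured plane:
`form x v` is its value at the point `x` on the tangent vector represented by `v`, and only the
values over the complement of `P` matter. -/
structure LogHiggsField (a : ι → ℤ) (P : Finset CP1) where
  form : Cone → (Fin 2 → ℂ) →ₗ[ℂ] Module.End ℂ (ι → ℂ)
  /-- the form vanishes on the kernel of the projection to the projective line -/
  radial : ∀ x : Cone, x.point ∉ P → form x x.1 = 0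
  /-- compatibility with the change of homogeneous coordinates -/
  equivariant : ∀ (t : ℂˣ) (x : Cone), x.point ∉ P → ∀ v : Fin 2 → ℂ,
    form (x.scale t) ((t : ℂ) • v) ∘ₗ weightAct a t = weightAct a t ∘ₗ form x v
  /-- holomorphic outside `P`, with at most simple poles at `P` -/
  simple_poles : ∀ (v : Fin 2 → ℂ) (e : ι → ℂ), ∃ h : (Fin 2 → ℂ) → (ι → ℂ),
    DifferentiableOn ℂ h {0}ᶜ ∧
      ∀ x : Cone, x.point ∉ P → divisorForm P x.1 • form x v e = h x.1

namespace LogHiggsField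

variable {a : ι → ℤ} {P : Finset CP1} (Φ : LogHiggsField a P)

/-- `F` is `Φ`-invariant, `Φ F ⊆ F ⊗ K(P)`. (It suffices to test this outside the finite set `P`,
because the fibres of `F` are closed and vary continuously.) -/
def Invariant (F : Subbundle a) : Prop :=
  ∀ x : Cone, x.point ∉ P → ∀ v : Fin 2 → ℂ, ∀ u ∈ F.fibre x, Φ.form x v u ∈ F.fibre x

/-- Stability of the Higgs bundle. -/
def IsStable : Prop :=
  ∀ F : Subbundle a, F.IsProper → Φ.Invariant F → F.slope < totalSlope a

/-- Semistability of the Higgs bundle. -/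
def IsSemistable : Prop :=
  ∀ F : Subbundle a, F.IsProper → Φ.Invariant F → F.slope ≤ totalSlope a

/-- Strict semistability: semistable but not stable. -/
def IsStrictlySemistable : Prop := Φ.IsSemistable ∧ ¬ Φ.IsStable

end LogHiggsField

end Bundles

/-- The weights of `E = V ⊕ L`, with `V = O(1) ⊕ O` and `L = O(-1)`. -/
def weight : Fin 3 → ℤ := ![1, 0, -1]

/-- The matrix of the Higgs field in the frame `logFrame` of `K(P) ⊗ O(2 - n)`; its blocks are
`γ = (g₁, g₂)` and `β = (-q g₂, q g₁)ᵀ`. -/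
def higgsMatrix (g₁ g₂ q : MvPolynomial (Fin 2) ℂ) (x : Fin 2 → ℂ) : Matrix (Fin 3) (Fin 3) ℂ :=
  !![0, 0, -(q.eval x * g₂.eval x);
     0, 0, q.eval x * g₁.eval x;
     g₁.eval x, g₂.eval x, 0]

/-- The nowhere vanishing section `(x₀ dx₁ - x₁ dx₀) / ∏ p, ℓ_p` of `K(P) ⊗ O(2 - n)`, where
`n = #P` and `ℓ_p` is a linear form vanishing at `p`; it has simple poles exactly at `P`, and
multiplication by it is the isomorphism `O(n - 2) ≅ K(P)` (unique up to a scalar). -/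
def logFrame (P : Finset CP1) (x : Fin 2 → ℂ) : (Fin 2 → ℂ) →ₗ[ℂ] ℂ :=
  (divisorForm P x)⁻¹ • (x 0 • LinearMap.proj 1 - x 1 • LinearMap.proj 0)

theorem logFrame_apply (P : Finset CP1) (x v : Fin 2 → ℂ) :
    logFrame P x v = (divisorForm P x)⁻¹ * area x v := by
  simp [logFrame, area]

theorem divisorForm_smul (P : Finset CP1) (t : ℂ) (x : Fin 2 → ℂ) :
    divisorForm P (t • x) = t ^ P.card * divisorForm P x := by
  unfold divisorForm
  rw [← Finset.prod_const, ← Finset.prod_mul_distrib]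
  refine Finset.prod_congr rfl fun p _ => ?_
  simp [area]
  ring

theorem area_eq_zero {x y : Fin 2 → ℂ} (hx : x ≠ 0) (hy : y ≠ 0) (h : area x y = 0) :
    Projectivization.mk ℂ x hx = Projectivization.mk ℂ y hy := by
  rw [Projectivization.mk_eq_mk_iff']
  unfold area at h
  by_cases h0 : y 0 = 0
  · have h1 : y 1 ≠ 0 := fun h1 => hy (by ext i; fin_cases i <;> simp [h0, h1])
    have hx0 : x 0 = 0 := by simpa [h0, h1] using h
    refine ⟨x 1 / y 1, ?_⟩
    ext i; fin_cases i <;> simp [h0, hx0, h1]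
  · refine ⟨x 0 / y 0, ?_⟩
    ext i; fin_cases i
    · simp [h0]
    · simp; field_simp; linear_combination h

theorem divisorForm_ne_zero {P : Finset CP1} {x : Cone} (hx : x.point ∉ P) :
    divisorForm P x.1 ≠ 0 := by
  rw [divisorForm, Finset.prod_ne_zero_iff]
  intro p hp h
  apply hx
  have := area_eq_zero p.rep_nonzero x.2 h
  rw [Projectivization.mk_rep] at this
  rw [Cone.point, ← this]
  exact hp

theorem eval_smul {g : MvPolynomial (Fin 2) ℂ} {d : ℕ} (hg : g.IsHomogeneous d) (t : ℂ)
    (x : Fin 2 → ℂ) : g.eval (t • x) = t ^ d * g.eval x := by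
  rw [MvPolynomial.eval_eq', MvPolynomial.eval_eq', Finset.mul_sum]
  refine Finset.sum_congr rfl fun m hm => ?_
  have hd : m 0 + m 1 = d := by
    have := hg (MvPolynomial.mem_support_iff.mp hm)
    simpa [Finsupp.weight_apply, Finsupp.sum_fintype] using this
  rw [← hd]
  simp [Fin.prod_univ_two, mul_pow, pow_add]
  ring

/-- The Higgs field `Φ = (0, β; γ, 0)` on `E = V ⊕ L`, with `γ = (g₁, g₂)` and
`β = (-q g₂, q g₁)ᵀ` with respect to `logFrame P`. -/
def nnoidHiggs {n : ℕ} (hn : 4 ≤ n) {P : Finset CP1} (hP : P.card = n)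
    {g₁ g₂ q : MvPolynomial (Fin 2) ℂ} (hg₁ : g₁.IsHomogeneous (n - 4))
    (hg₂ : g₂.IsHomogeneous (n - 3)) (hq : q.IsHomogeneous 3) : LogHiggsField weight P where
  form x := (logFrame P x.1).smulRight (Matrix.toLin' (higgsMatrix g₁ g₂ q x.1))
  radial x _ := by
    ext
    simp [logFrame_apply, area, mul_comm]
  equivariant t x hx v := by
    have ht : (t : ℂ) ≠ 0 := t.ne_zero
    have hD := divisorForm_ne_zero hx
    obtain ⟨m, rfl⟩ := Nat.exists_eq_add_of_le hn
    have e1 : 4 + m - 4 = m := by omega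
    have e2 : 4 + m - 3 = m + 1 := by omega
    rw [e1] at hg₁
    rw [e2] at hg₂
    refine LinearMap.ext fun e => funext fun i => ?_
    have ha : ∀ w, area ((t : ℂ) • x.1) w = t * area x.1 w := fun w => by
      simp [area]; ring
    fin_cases i <;>
      simp [logFrame_apply, Cone.scale, divisorForm_smul, hP, ha, weightAct, weight, higgsMatrix,
        dotProduct, Fin.sum_univ_three, eval_smul hg₁, eval_smul hg₂,
        eval_smul hq] <;>
      field_simp <;> ring
  simple_poles v e := by
    refine ⟨fun x => area x v • (higgsMatrix g₁ g₂ q x).mulVec e, ?_, ?_⟩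
    · have hpoly : ∀ p : MvPolynomial (Fin 2) ℂ,
          Differentiable ℂ fun x : Fin 2 → ℂ => p.eval x := fun p x =>
        ((AnalyticOnNhd.eval_mvPolynomial p) x (Set.mem_univ x)).differentiableAt
      have h1 := hpoly g₁
      have h2 := hpoly g₂
      have h3 := hpoly q
      refine Differentiable.differentiableOn ?_
      refine differentiable_pi.mpr fun i => ?_
      fin_cases i <;>
        simp [area, higgsMatrix, dotProduct, Fin.sum_univ_three] <;> fun_prop
    · intro x hx
      have hD := divisorForm_ne_zero hx
      simp [logFrame_apply, smul_smul, hD]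

/-- The fibre of `ker γ ⊆ V ⊆ E`. -/
def kerGamma (g₁ g₂ : MvPolynomial (Fin 2) ℂ) (x : Cone) : Submodule ℂ (Fin 3 → ℂ) where
  carrier := {u | u 2 = 0 ∧ g₁.eval x.1 * u 0 + g₂.eval x.1 * u 1 = 0}
  zero_mem' := by simp
  add_mem' := by
    rintro u w ⟨h1, h2⟩ ⟨h3, h4⟩
    refine ⟨by simp [h1, h3], ?_⟩
    simp only [Pi.add_apply]
    linear_combination h2 + h4
  smul_mem' := by
    rintro c u ⟨h1, h2⟩
    refine ⟨by simp [h1], ?_⟩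
    simp only [Pi.smul_apply, smul_eq_mul]
    linear_combination c * h2

/-- The fibre of `L ⊆ E`. -/
def fibreL : Submodule ℂ (Fin 3 → ℂ) := Submodule.span ℂ {Pi.single 2 1}

end NNoid

end

/-! In the frame `logFrame` the Higgs field is a matrix N with blocks β and γ. Since β is q times
the vector (-g₂, g₁), which spans ker γ, γβ = 0 and N³ = 0. Where q ≠ 0, N is a single Jordan block,
because g₁ and g₂ have no common zero. Its only invariant line and plane are ker N = ker γ ⊂ V and
ker N² = ker γ ⊕ L. The lemmas `le_kerGamma_of_finrank_eq_one` and
`gammaForm_eq_zero_of_finrank_eq_two` prove this by direct computation.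

This pins down an invariant subbundle only off P and the zeros of q. That set is dense, and fibres
have continuous local frames, so `Subbundle.fibre_equation` extends the equations of the fibre to
every point.

For degrees, homogeneous frames of ker γ and ker γ ⊕ L trivialise the twisted determinants
explicitly. Uniqueness of the degree comes down to Liouville's theorem: O(k) with k ≠ 0 has no
nowhere vanishing section. Stability is then read off from two slopes. -/

namespace NNoid

open Filter Topology

/-! ### Degrees of subbundles and their uniqueness -/

section Degree

/-- A nowhere vanishing holomorphic function on the punctured plane cannot be homogeneous of
positive degree. -/
theorem homogeneous_degree_nonpos {f : (Fin 2 → ℂ) → ℂ} {k : ℤ}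
    (hf : DifferentiableOn ℂ f {0}ᶜ) (hne : ∀ x ≠ 0, f x ≠ 0)
    (hom : ∀ (t : ℂˣ) (x : Fin 2 → ℂ), x ≠ 0 → f ((t : ℂ) • x) = (t : ℂ) ^ k * f x) : k ≤ 0 := by
  by_contra! hk
  have h1 : ∀ z : ℂ, (![1, z] : Fin 2 → ℂ) ≠ 0 := fun z h => by simpa using congrFun h 0
  have h2 : ∀ z : ℂ, (![z, 1] : Fin 2 → ℂ) ≠ 0 := fun z h => by simpa using congrFun h 1
  have dat : ∀ x ≠ 0, DifferentiableAt ℂ f x := fun x hx =>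
    (hf x hx).differentiableAt (isOpen_compl_singleton.mem_nhds hx)
  have d1 : Differentiable ℂ fun z : ℂ => (![1, z] : Fin 2 → ℂ) :=
    differentiable_pi.mpr fun i => by fin_cases i <;> simp
  have d2 : Differentiable ℂ fun z : ℂ => (![z, 1] : Fin 2 → ℂ) :=
    differentiable_pi.mpr fun i => by fin_cases i <;> simp
  have hA : Differentiable ℂ fun z : ℂ => (f ![1, z])⁻¹ := fun z =>
    ((dat _ (h1 z)).comp z (d1 z)).inv (hne _ (h1 z))
  have hB : Continuous fun z : ℂ => (f ![z, 1])⁻¹ :=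
    Differentiable.continuous (𝕜 := ℂ) fun z => ((dat _ (h2 z)).comp z (d2 z)).inv (hne _ (h2 z))
  -- The two affine charts are compared through (1, z) = z • (z⁻¹, 1).
  have key : ∀ z : ℂ, z ≠ 0 → (f ![1, z])⁻¹ = z⁻¹ ^ k * (f ![z⁻¹, 1])⁻¹ := fun z hz => by
    have := hom (Units.mk0 z hz) ![z⁻¹, 1] (h2 _)
    rw [show ((Units.mk0 z hz : ℂˣ) : ℂ) • (![z⁻¹, 1] : Fin 2 → ℂ) = ![1, z] by simp [hz]] at this
    rw [this, mul_inv, Units.val_mk0, inv_zpow]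
  -- Near infinity 1/f(1, z) is z⁻ᵏ times a function bounded near z⁻¹ = 0. As k > 0 it tends to 0,
  -- so by Liouville this entire function vanishes, which a reciprocal of a nonzero value cannot do.
  have hlim : Tendsto (fun z : ℂ => (f ![1, z])⁻¹) (cocompact ℂ) (𝓝 0) := by
    have hinv : Tendsto (fun z : ℂ => z⁻¹) (cocompact ℂ) (𝓝 0) := by
      rw [← Metric.cobounded_eq_cocompact]
      exact tendsto_inv₀_cobounded
    obtain ⟨m, rfl⟩ := Int.eq_ofNat_of_zero_le hk.le
    have hm : m ≠ 0 := by rintro rfl; simp at hk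
    have hcont : Tendsto (fun w : ℂ => w ^ m * (f ![w, 1])⁻¹) (𝓝 0) (𝓝 0) := by
      have : Continuous fun w : ℂ => w ^ m * (f ![w, 1])⁻¹ := (continuous_pow m).mul hB
      simpa [hm] using this.tendsto 0
    refine (hcont.comp hinv).congr' ?_
    have : ∀ᶠ z : ℂ in cocompact ℂ, z ≠ 0 := by
      filter_upwards [isCompact_singleton (x := (0 : ℂ)).compl_mem_cocompact] with z hz using hz
    filter_upwards [this] with z hz
    simp [key z hz]
  exact inv_ne_zero (hne _ (h1 0)) (hA.apply_eq_of_tendsto_cocompact 0 hlim)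

/-- A nowhere vanishing holomorphic function on the punctured plane which is homogeneous has
degree zero. -/
theorem homogeneous_degree_eq_zero {f : (Fin 2 → ℂ) → ℂ} {k : ℤ}
    (hf : DifferentiableOn ℂ f {0}ᶜ) (hne : ∀ x ≠ 0, f x ≠ 0)
    (hom : ∀ (t : ℂˣ) (x : Fin 2 → ℂ), x ≠ 0 → f ((t : ℂ) • x) = (t : ℂ) ^ k * f x) : k = 0 := by
  refine le_antisymm (homogeneous_degree_nonpos hf hne hom) ?_
  have := homogeneous_degree_nonpos (f := fun x => (f x)⁻¹) (k := -k)
    (hf.inv hne) (fun x hx => inv_ne_zero (hne x hx))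
    (fun t x hx => by rw [hom t x hx, mul_inv, zpow_neg])
  omega

variable {ι : Type}

theorem Cone.scale_val (t : ℂˣ) (x : Cone) : (x.scale t).1 = (t : ℂ) • x.1 := rfl

theorem weightAct_apply (a : ι → ℤ) (t : ℂˣ) (u : ι → ℂ) (i : ι) :
    weightAct a t u i = (t : ℂ) ^ a i * u i := by
  simp [weightAct]

theorem Subbundle.finrank_fibre {a : ι → ℤ} (F : Subbundle a) (x : Cone) :
    Module.finrank ℂ (F.fibre x) = F.rank := by
  obtain ⟨U, s, -, hx, -, h⟩ := F.exists_frame x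
  obtain ⟨hli, hsp⟩ := h x hx
  rw [← hsp, finrank_span_eq_card hli, Fintype.card_fin]

theorem exists_cone : Nonempty Cone := ⟨⟨![1, 0], fun h => by simpa using congrFun h 0⟩⟩

/-- The rank is the dimension of any fibre, and frames are only asserted to exist, so the fibres
carry all the data. -/
theorem Subbundle.ext_fibre {a : ι → ℤ} {F G : Subbundle a} (h : ∀ x, F.fibre x = G.fibre x) :
    F = G := by
  obtain ⟨x⟩ := exists_cone
  exact Subbundle.ext (by rw [← F.finrank_fibre x, h x, G.finrank_fibre x]) (funext h)

/-- The subbundle spanned by homogeneous global sections `s j` of `(⨁ i, O(a i)) ⊗ O(-d j)`. -/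
def Subbundle.ofFrame (a : ι → ℤ) {r : ℕ} (d : Fin r → ℤ) (s : Fin r → (Fin 2 → ℂ) → (ι → ℂ))
    (hs : ∀ j, DifferentiableOn ℂ (s j) {0}ᶜ)
    (hli : ∀ x : Cone, LinearIndependent ℂ fun j => s j x.1)
    (heq : ∀ (t : ℂˣ) (x : Cone) (j : Fin r),
      s j (x.scale t).1 = (t : ℂ) ^ (-d j) • weightAct a t (s j x.1)) : Subbundle a where
  rank := r
  fibre x := Submodule.span ℂ (Set.range fun j => s j x.1)
  equivariant t x := by
    rw [Submodule.map_span, ← Set.range_comp]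
    apply le_antisymm <;> rw [Submodule.span_le] <;> rintro _ ⟨j, rfl⟩
    · change s j (x.scale t).1 ∈ _
      rw [heq]
      exact Submodule.smul_mem _ _ (Submodule.subset_span ⟨j, rfl⟩)
    · have : weightAct a t (s j x.1) = (t : ℂ) ^ d j • s j (x.scale t).1 := by
        rw [heq, smul_smul, ← zpow_add₀ t.ne_zero]
        simp
      change weightAct a t (s j x.1) ∈ _
      rw [this]
      exact Submodule.smul_mem _ _ (Submodule.subset_span ⟨j, rfl⟩)
  exists_frame x := ⟨{0}ᶜ, s, isOpen_compl_singleton, x.2, hs, fun y _ => ⟨hli y, rfl⟩⟩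

/-- The wedge of the frame trivialises the twisted determinant. Rescaling x multiplies column j of a
minor by t ^ (-d j) and row i by t ^ a (I i), which gives the required weight. -/
theorem Subbundle.ofFrame_hasDegree (a : ι → ℤ) {r : ℕ} (d : Fin r → ℤ)
    (s : Fin r → (Fin 2 → ℂ) → (ι → ℂ)) (hs : ∀ j, DifferentiableOn ℂ (s j) {0}ᶜ)
    (hli : ∀ x : Cone, LinearIndependent ℂ fun j => s j x.1)
    (heq : ∀ (t : ℂˣ) (x : Cone) (j : Fin r),
      s j (x.scale t).1 = (t : ℂ) ^ (-d j) • weightAct a t (s j x.1)) :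
    (Subbundle.ofFrame a d s hs hli heq).HasDegree (∑ j, d j) := by
  refine ⟨fun x I => Matrix.det (Matrix.of fun i j => s j x (I i)), fun I => ?_, fun t x I => ?_,
    fun x => ⟨fun j => s j x.1, hli x, rfl, fun I => rfl⟩⟩
  · change Fin r → ι at I
    simp only [Matrix.det_apply, Matrix.of_apply]
    refine DifferentiableOn.fun_sum fun σ _ => DifferentiableOn.const_smul ?_ _
    exact fun x hx => (HasFDerivWithinAt.finsetProd fun j _ =>
      (differentiableOn_pi.mp (hs j) (I (σ j)) x hx).hasFDerivWithinAt).differentiableWithinAt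
  · change Fin r → ι at I
    have ht : (t : ℂ) ≠ 0 := t.ne_zero
    have e : ∀ i j, s j (x.scale t).1 (I i) =
        (t : ℂ) ^ (-d j) * ((t : ℂ) ^ a (I i) * s j x.1 (I i)) := fun i j => by
      rw [heq, Pi.smul_apply, weightAct_apply, smul_eq_mul]
    change Matrix.det (Matrix.of fun i j : Fin r => s j (x.scale t).1 (I i)) =
      _ * Matrix.det (Matrix.of fun i j : Fin r => s j x.1 (I i))
    simp only [e]
    have h1 := Matrix.det_mul_row (fun j : Fin r => (t : ℂ) ^ (-d j))
      (Matrix.of fun i j : Fin r => (t : ℂ) ^ a (I i) * s j x.1 (I i))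
    have h2 := Matrix.det_mul_column (fun i : Fin r => (t : ℂ) ^ a (I i))
      (Matrix.of fun i j : Fin r => s j x.1 (I i))
    simp only [Matrix.of_apply] at h1 h2
    have hsum : ∀ u : Fin r → ℤ, (t : ℂ) ^ (∑ j, u j) = ∏ j, (t : ℂ) ^ u j := fun u => by
      induction (Finset.univ : Finset (Fin r)) using Finset.cons_induction with
      | empty => simp
      | cons j A hj ih => rw [Finset.sum_cons, Finset.prod_cons, zpow_add₀ ht, ih]
    rw [h1, h2, sub_eq_add_neg, zpow_add₀ ht, ← Finset.sum_neg_distrib]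
    change _ = (t : ℂ) ^ (∑ j : Fin r, a (I j)) * (t : ℂ) ^ (∑ j : Fin r, -d j) * _
    rw [hsum, hsum]
    ring

variable [Fintype ι]

/-- Expansion of the determinant of a product along the choices of rows of the second factor. -/
theorem det_mul_eq_sum_minors {r : ℕ} (C : Matrix (Fin r) ι ℂ) (B : Matrix ι (Fin r) ℂ) :
    (C * B).det = ∑ I : Fin r → ι, (∏ i, C i (I i)) *
      Matrix.det (Matrix.of fun i j => B (I i) j) := by
  classical
  have hrow : (C * B : Matrix (Fin r) (Fin r) ℂ) = fun i => ∑ k, C i k • B k := by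
    ext i j
    simp [Matrix.mul_apply]
  change Matrix.detRowAlternating.toMultilinearMap (C * B) = _
  rw [hrow, MultilinearMap.map_sum]
  refine Finset.sum_congr rfl fun I _ => ?_
  rw [MultilinearMap.map_smul_univ]
  rfl

/-- A linearly independent family of vectors has a nonvanishing maximal minor. -/
theorem exists_minor_ne_zero {r : ℕ} {b : Fin r → (ι → ℂ)} (hb : LinearIndependent ℂ b) :
    ∃ I : Fin r → ι, Matrix.det (Matrix.of fun i j => b j (I i)) ≠ 0 := by
  classical
  by_contra! h
  -- A left inverse T of the matrix B with columns b gives det (T B) = 1, and this determinant is a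
  -- combination of the maximal minors of B.
  obtain ⟨T, hT⟩ := (Fintype.linearCombination ℂ b).exists_leftInverse_of_injective
    (LinearMap.ker_eq_bot.mpr hb.fintypeLinearCombination_injective)
  have hCB : LinearMap.toMatrix' T * (Matrix.of fun i j => b j i) = 1 := by
    rw [← LinearMap.toMatrix'_id, ← hT, LinearMap.toMatrix'_comp]
    congr 1
    ext i j
    simp [LinearMap.toMatrix'_apply, Fintype.linearCombination_apply, Pi.single_apply, ite_apply]
  have := det_mul_eq_sum_minors (LinearMap.toMatrix' T) (Matrix.of fun i j => b j i)
  rw [hCB, Matrix.det_one] at this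
  simp [h] at this

/-- The maximal minors of two bases of the same subspace are proportional. -/
theorem exists_minors_proportional {r : ℕ} {b b' : Fin r → (ι → ℂ)}
    (hb' : LinearIndependent ℂ b')
    (h : Submodule.span ℂ (Set.range b') ≤ Submodule.span ℂ (Set.range b)) :
    ∃ c : ℂ, c ≠ 0 ∧ ∀ I : Fin r → ι, Matrix.det (Matrix.of fun i j => b' j (I i)) =
      c * Matrix.det (Matrix.of fun i j => b j (I i)) := by
  have hmem : ∀ j, ∃ m : Fin r → ℂ, ∑ k, m k • b k = b' j := fun j =>
    (Submodule.mem_span_range_iff_exists_fun ℂ).mp (h (Submodule.subset_span ⟨j, rfl⟩))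
  choose M hM using hmem
  have hdet : ∀ I : Fin r → ι, Matrix.det (Matrix.of fun i j => b' j (I i)) =
      (Matrix.of fun k j => M j k).det * Matrix.det (Matrix.of fun i j => b j (I i)) := fun I => by
    rw [mul_comm, ← Matrix.det_mul]
    congr 1
    ext i j
    simp [← hM, Matrix.mul_apply, mul_comm]
  -- The factor is the determinant of the change of basis. Were it zero, all minors of `b'` would
  -- vanish.
  refine ⟨_, fun h0 => ?_, hdet⟩
  obtain ⟨I, hI⟩ := exists_minor_ne_zero hb'
  exact hI (by rw [hdet, h0, zero_mul])

/-- Two trivialisations differ by a nowhere vanishing scalar c, locally a quotient of Plücker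
coordinates and hence holomorphic. It is homogeneous of weight d - d', which must be 0. -/
theorem Subbundle.HasDegree.unique {a : ι → ℤ} {F : Subbundle a} {d d' : ℤ}
    (h : F.HasDegree d) (h' : F.HasDegree d') : d = d' := by
  obtain ⟨ψ, hψ, eψ, bψ⟩ := h
  obtain ⟨ψ', hψ', eψ', bψ'⟩ := h'
  have hne : ∀ x : Cone, ∃ I, ψ x.1 I ≠ 0 := fun x => by
    obtain ⟨b, hb, -, e⟩ := bψ x
    obtain ⟨I, hI⟩ := exists_minor_ne_zero hb
    exact ⟨I, by rwa [e]⟩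
  have hprop : ∀ x : Fin 2 → ℂ, ∃ c : ℂ, x ≠ 0 → c ≠ 0 ∧ ∀ I, ψ' x I = c * ψ x I := fun x => by
    by_cases hx : x = 0
    · exact ⟨0, fun h => (h hx).elim⟩
    obtain ⟨b, hb, sb, e⟩ := bψ ⟨x, hx⟩
    obtain ⟨b', hb', sb', e'⟩ := bψ' ⟨x, hx⟩
    obtain ⟨c, hc, hI⟩ := exists_minors_proportional (b := b) hb' (by rw [sb, sb'])
    exact ⟨c, fun _ => ⟨hc, fun I => by rw [e', e, hI]⟩⟩
  choose c hc using hprop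
  have hdiff : DifferentiableOn ℂ c {0}ᶜ := fun x hx => by
    obtain ⟨I, hI⟩ := hne ⟨x, hx⟩
    have hO : IsOpen ({0}ᶜ : Set (Fin 2 → ℂ)) := isOpen_compl_singleton
    have d1 := (hψ I x hx).differentiableAt (hO.mem_nhds hx)
    have d2 := (hψ' I x hx).differentiableAt (hO.mem_nhds hx)
    have d3 : DifferentiableAt ℂ (fun y => ψ' y I / ψ y I) x := by
      simp only [div_eq_mul_inv]
      exact d2.mul (d1.inv hI)
    refine (d3.congr_of_eventuallyEq ?_).differentiableWithinAt
    filter_upwards [hO.mem_nhds hx, d1.continuousAt.eventually_ne hI] with y hy hyI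
    simp [(hc y hy).2 I, hyI]
  have hom : ∀ (t : ℂˣ) (x : Fin 2 → ℂ), x ≠ 0 →
      c ((t : ℂ) • x) = (t : ℂ) ^ (d - d') * c x := fun t x hx => by
    obtain ⟨I, hI⟩ := hne ⟨x, hx⟩
    have ht : (t : ℂ) ≠ 0 := t.ne_zero
    have e1 := eψ t ⟨x, hx⟩ I
    have e2 := eψ' t ⟨x, hx⟩ I
    simp only [Cone.scale_val] at e1 e2
    rw [(hc _ (smul_ne_zero ht hx)).2, (hc x hx).2, e1,
      show (∑ j, a (I j)) - d' = ((∑ j, a (I j)) - d) + (d - d') by ring, zpow_add₀ ht] at e2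
    refine mul_right_cancel₀ (mul_ne_zero (zpow_ne_zero ((∑ j, a (I j)) - d) ht) hI) ?_
    linear_combination e2
  have := homogeneous_degree_eq_zero hdiff (fun x hx => (hc x hx).1) hom
  omega

theorem Subbundle.HasDegree.degree_eq {a : ι → ℤ} {F : Subbundle a} {d : ℤ}
    (h : F.HasDegree d) : F.degree = d := by
  have hex : ∃ d, F.HasDegree d := ⟨d, h⟩
  rw [Subbundle.degree, dif_pos hex]
  exact hex.choose_spec.unique h

end Degree

/-! ### Extending fibre equations from a dense open set -/

theorem continuous_eval (p : MvPolynomial (Fin 2) ℂ) : Continuous fun x => p.eval x :=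
  MvPolynomial.continuous_eval p

theorem differentiable_eval (p : MvPolynomial (Fin 2) ℂ) :
    Differentiable ℂ fun x : Fin 2 → ℂ => p.eval x := fun x =>
  ((AnalyticOnNhd.eval_mvPolynomial p) x (Set.mem_univ x)).differentiableAt

/-- The nonvanishing locus of a nonzero polynomial is dense. -/
theorem dense_eval_ne_zero {p : MvPolynomial (Fin 2) ℂ} (hp : p ≠ 0) :
    Dense {x : Fin 2 → ℂ | p.eval x ≠ 0} := by
  intro x
  by_contra hx
  rw [mem_closure_iff_frequently, not_frequently] at hx
  refine hp (MvPolynomial.funext fun y => ?_)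
  have h0 : (fun y : Fin 2 → ℂ => p.eval y) =ᶠ[𝓝 x] 0 := by
    filter_upwards [hx] with y hy using not_not.mp hy
  simpa using (AnalyticOnNhd.eval_mvPolynomial p).eqOn_zero_of_preconnected_of_eventuallyEq_zero
    isPreconnected_univ (Set.mem_univ x) h0 (Set.mem_univ y)

/-- The polynomial whose values are `divisorForm P`. -/
noncomputable def divisorPoly (P : Finset CP1) : MvPolynomial (Fin 2) ℂ :=
  ∏ p ∈ P, (MvPolynomial.C (p.rep 0) * MvPolynomial.X 1 -
    MvPolynomial.C (p.rep 1) * MvPolynomial.X 0)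

theorem eval_divisorPoly (P : Finset CP1) (x : Fin 2 → ℂ) :
    (divisorPoly P).eval x = divisorForm P x := by
  simp [divisorPoly, divisorForm, area, map_prod]

theorem exists_area_ne_zero {x : Fin 2 → ℂ} (hx : x ≠ 0) : ∃ v, area x v ≠ 0 := by
  by_contra! h
  refine hx (funext fun i => ?_)
  fin_cases i
  · simpa [area] using h ![0, 1]
  · simpa [area] using h ![1, 0]

theorem divisorPoly_ne_zero (P : Finset CP1) : divisorPoly P ≠ 0 := by
  refine Finset.prod_ne_zero_iff.mpr fun p _ h => ?_
  obtain ⟨v, hv⟩ := exists_area_ne_zero p.rep_nonzero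
  exact hv (by simpa [area] using congrArg (MvPolynomial.eval v) h)

theorem point_notMem_of_divisorForm_ne_zero {P : Finset CP1} {x : Cone}
    (hx : divisorForm P x.1 ≠ 0) : x.point ∉ P := by
  intro hP
  refine hx (Finset.prod_eq_zero hP ?_)
  obtain ⟨c, hc⟩ := Projectivization.exists_smul_eq_mk_rep ℂ x.1 x.2
  rw [Cone.point, ← hc]
  simp [area, Units.smul_def]
  ring

/-- A linear equation with continuous coefficients which holds on the fibres of a subbundle over
the nonvanishing locus of a polynomial holds on all fibres. -/
theorem Subbundle.fibre_equation {ι : Type} {a : ι → ℤ} (F : Subbundle a)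
    {p : MvPolynomial (Fin 2) ℂ} (hp : p ≠ 0) (φ : (Fin 2 → ℂ) → (ι → ℂ) →ₗ[ℂ] ℂ)
    (hφ : Continuous fun z : (Fin 2 → ℂ) × (ι → ℂ) => φ z.1 z.2)
    (h : ∀ x : Cone, p.eval x.1 ≠ 0 → ∀ u ∈ F.fibre x, φ x.1 u = 0) (x : Cone) :
    ∀ u ∈ F.fibre x, φ x.1 u = 0 := by
  obtain ⟨U, s, hU, hx, hs, hF⟩ := F.exists_frame x
  suffices F.fibre x ≤ LinearMap.ker (φ x.1) from fun u hu => this hu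
  rw [← (hF x hx).2, Submodule.span_le]
  rintro _ ⟨j, rfl⟩
  change φ x.1 (s j x.1) = 0
  -- A nonzero value at x would persist along the local frame near x, but points with p ≠ 0, where
  -- the value is zero, accumulate at x.
  by_contra hne
  have hsc : ContinuousAt (s j) x.1 := (hs j).continuousOn.continuousAt (hU.mem_nhds hx)
  have hcont : ContinuousAt (fun y => φ y (s j y)) x.1 :=
    hφ.continuousAt.comp (f := fun y => (y, s j y)) (continuousAt_id.prodMk hsc)
  have hfreq := mem_closure_iff_frequently.mp (dense_eval_ne_zero hp x.1)
  have hev : ∀ᶠ y in 𝓝 x.1, y ∈ U ∧ y ≠ 0 ∧ φ y (s j y) ≠ 0 :=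
    by
    filter_upwards [hU.mem_nhds hx, isOpen_compl_singleton.mem_nhds x.2, hcont.eventually_ne hne]
      with y h₁ h₂ h₃ using ⟨h₁, h₂, h₃⟩
  obtain ⟨y, hy, hyU, hy0, hyne⟩ := (hfreq.and_eventually hev).exists
  refine hyne (h ⟨y, hy0⟩ hy _ ?_)
  rw [← (hF ⟨y, hy0⟩ hyU).2]
  exact Submodule.subset_span ⟨j, rfl⟩

/-! ### Invariant subspaces of the Higgs matrix -/

section Kernel

variable {g₁ g₂ q : MvPolynomial (Fin 2) ℂ}

theorem higgsMatrix_mulVec (x : Fin 2 → ℂ) (u : Fin 3 → ℂ) :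
    (higgsMatrix g₁ g₂ q x).mulVec u = ![-(q.eval x * g₂.eval x) * u 2,
      q.eval x * g₁.eval x * u 2, g₁.eval x * u 0 + g₂.eval x * u 1] := by
  ext i
  fin_cases i <;> simp [higgsMatrix, Matrix.mulVec, dotProduct, Fin.sum_univ_three]

/-- The linear form `γ` on `E` with values in `L`, in the frame `logFrame`. -/
noncomputable def gammaForm (g₁ g₂ : MvPolynomial (Fin 2) ℂ) (x : Fin 2 → ℂ) : (Fin 3 → ℂ) →ₗ[ℂ] ℂ :=
  g₁.eval x • LinearMap.proj 0 + g₂.eval x • LinearMap.proj 1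

theorem gammaForm_apply (x : Fin 2 → ℂ) (u : Fin 3 → ℂ) :
    gammaForm g₁ g₂ x u = g₁.eval x * u 0 + g₂.eval x * u 1 := rfl

theorem continuous_gammaForm :
    Continuous fun z : (Fin 2 → ℂ) × (Fin 3 → ℂ) => gammaForm g₁ g₂ z.1 z.2 := by
  have h₁ := continuous_eval g₁
  have h₂ := continuous_eval g₂
  simp only [gammaForm_apply]
  fun_prop

theorem mem_kerGamma {x : Cone} {u : Fin 3 → ℂ} :
    u ∈ kerGamma g₁ g₂ x ↔ u 2 = 0 ∧ gammaForm g₁ g₂ x.1 u = 0 := Iff.rfl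

theorem mem_kerGamma_sup_fibreL {x : Cone} {u : Fin 3 → ℂ} :
    u ∈ kerGamma g₁ g₂ x ⊔ fibreL ↔ gammaForm g₁ g₂ x.1 u = 0 := by
  constructor
  · suffices kerGamma g₁ g₂ x ⊔ fibreL ≤ LinearMap.ker (gammaForm g₁ g₂ x.1) from fun h => this h
    refine sup_le (fun u hu => hu.2) ?_
    rw [fibreL, Submodule.span_le, Set.singleton_subset_iff]
    simp [gammaForm]
  · intro h
    have : u = ![u 0, u 1, 0] + u 2 • Pi.single 2 1 := by
      ext i
      fin_cases i <;> simp
    rw [this]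
    exact Submodule.add_mem_sup ⟨by simp, by simpa [gammaForm] using h⟩
      (Submodule.smul_mem _ _ (Submodule.subset_span rfl))

/-- An invariant line of `higgsMatrix` at a point where `q ≠ 0` is the kernel of `γ`. -/
theorem le_kerGamma_of_finrank_eq_one {x : Cone} (hg : ¬(g₁.eval x.1 = 0 ∧ g₂.eval x.1 = 0))
    (hq : q.eval x.1 ≠ 0) {W : Submodule ℂ (Fin 3 → ℂ)}
    (hW : ∀ u ∈ W, (higgsMatrix g₁ g₂ q x.1).mulVec u ∈ W) (hdim : Module.finrank ℂ W = 1) :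
    W ≤ kerGamma g₁ g₂ x := by
  obtain ⟨⟨v, hv⟩, -, hspan⟩ := finrank_eq_one_iff'.mp hdim
  have hvk : v ∈ kerGamma g₁ g₂ x := by
    obtain ⟨l, hl⟩ := hspan ⟨_, hW v hv⟩
    have hl : l • v = (higgsMatrix g₁ g₂ q x.1).mulVec v := congrArg Subtype.val hl
    rw [higgsMatrix_mulVec] at hl
    have h0 : l * v 0 = -(q.eval x.1 * g₂.eval x.1) * v 2 := by simpa using congrFun hl 0
    have h1 : l * v 1 = q.eval x.1 * g₁.eval x.1 * v 2 := by simpa using congrFun hl 1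
    have h2 : l * v 2 = g₁.eval x.1 * v 0 + g₂.eval x.1 * v 1 := by simpa using congrFun hl 2
    -- For an eigenvector with eigenvalue l, l² v₂ = l γ(v) = γ(β v₂) = 0. If l = 0, then β v₂ = 0
    -- with β ≠ 0 at x.
    have hv2 : v 2 = 0 := by
      have : l ^ 2 * v 2 = 0 := by
        linear_combination l * h2 + g₁.eval x.1 * h0 + g₂.eval x.1 * h1
      rcases mul_eq_zero.mp this with hl0 | hv2
      · obtain rfl : l = 0 := pow_eq_zero_iff two_ne_zero |>.mp hl0
        by_contra hv2
        exact hg ⟨by simpa [hq, hv2] using h1.symm, by simpa [hq, hv2] using h0.symm⟩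
      · exact hv2
    exact ⟨hv2, by rw [← h2, hv2, mul_zero]⟩
  intro u hu
  obtain ⟨c, hc⟩ := hspan ⟨u, hu⟩
  have hc : c • v = u := congrArg Subtype.val hc
  exact hc ▸ Submodule.smul_mem _ _ hvk

/-- An invariant plane of `higgsMatrix` at a point where `q ≠ 0` lies in the kernel of `γ` on `E`:
a vector outside this kernel is cyclic. -/
theorem gammaForm_eq_zero_of_finrank_eq_two {x : Fin 2 → ℂ} (hq : q.eval x ≠ 0)
    {W : Submodule ℂ (Fin 3 → ℂ)}
    (hW : ∀ u ∈ W, (higgsMatrix g₁ g₂ q x).mulVec u ∈ W) (hdim : Module.finrank ℂ W = 2)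
    {u : Fin 3 → ℂ} (hu : u ∈ W) : gammaForm g₁ g₂ x u = 0 := by
  by_contra hne
  rw [gammaForm_apply] at hne
  set N := higgsMatrix g₁ g₂ q x with hN
  let A : Matrix (Fin 3) (Fin 3) ℂ := Matrix.of ![u, N.mulVec u, N.mulVec (N.mulVec u)]
  -- With c = γ(u), N²u = βc has no L-component because γβ = 0. It is parallel to the V-part of Nu,
  -- so only one term of the determinant survives, namely -q c³.
  have hdet : A.det = -q.eval x * (g₁.eval x * u 0 + g₂.eval x * u 1) ^ 3 := by
    simp only [A, hN, higgsMatrix_mulVec, Matrix.det_fin_three]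
    simp
    ring
  have hli := Matrix.linearIndependent_rows_of_det_ne_zero (A := A)
    (hdet ▸ mul_ne_zero (neg_ne_zero.mpr hq) (pow_ne_zero 3 hne))
  have hle : Submodule.span ℂ (Set.range fun i => A i) ≤ W := by
    rw [Submodule.span_le]
    rintro _ ⟨i, rfl⟩
    fin_cases i
    exacts [hu, hW _ hu, hW _ (hW _ hu)]
  have := Submodule.finrank_mono hle
  rw [finrank_span_eq_card hli, hdim] at this
  simp at this

/-! ### The subbundles ker γ and ker γ ⊕ L -/

/-- The homogeneous global section `(-g₂, g₁)` of `V`, which spans `ker γ`. -/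
noncomputable def kerSection (g₁ g₂ : MvPolynomial (Fin 2) ℂ) (x : Fin 2 → ℂ) : Fin 3 → ℂ :=
  ![-g₂.eval x, g₁.eval x, 0]

theorem differentiable_kerSection : Differentiable ℂ (kerSection g₁ g₂) := by
  have h₁ := differentiable_eval g₁
  have h₂ := differentiable_eval g₂
  refine differentiable_pi.mpr fun i => ?_
  fin_cases i <;> simp [kerSection] <;> fun_prop

theorem kerSection_ne_zero {x : Fin 2 → ℂ} (hg : ¬(g₁.eval x = 0 ∧ g₂.eval x = 0)) :
    kerSection g₁ g₂ x ≠ 0 := fun h =>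
  hg ⟨by simpa [kerSection] using congrFun h 1, by simpa [kerSection] using congrFun h 0⟩

/-- The entries have degrees n - 3 and n - 4, which are the weights 1 and 0 of V minus 4 - n. This
shift is the degree of ker γ. -/
theorem kerSection_scale {n : ℕ} (hn : 4 ≤ n) (hg₁ : g₁.IsHomogeneous (n - 4))
    (hg₂ : g₂.IsHomogeneous (n - 3)) (t : ℂˣ) (x : Fin 2 → ℂ) :
    kerSection g₁ g₂ ((t : ℂ) • x) =
      (t : ℂ) ^ (-(4 - n : ℤ)) • weightAct weight t (kerSection g₁ g₂ x) := by
  have ht : (t : ℂ) ≠ 0 := t.ne_zero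
  obtain ⟨m, rfl⟩ := Nat.exists_eq_add_of_le hn
  rw [show 4 + m - 4 = m by omega] at hg₁
  rw [show 4 + m - 3 = m + 1 by omega] at hg₂
  have e : -(4 - ((4 + m : ℕ) : ℤ)) = m := by push_cast; ring
  rw [e, zpow_natCast]
  ext i
  fin_cases i <;>
    simp [kerSection, weightAct_apply, weight, eval_smul hg₁, eval_smul hg₂, pow_succ]
  ring

theorem span_kerSection {x : Cone} (hg : ¬(g₁.eval x.1 = 0 ∧ g₂.eval x.1 = 0)) :
    Submodule.span ℂ {kerSection g₁ g₂ x.1} = kerGamma g₁ g₂ x := by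
  refine le_antisymm ?_ fun u hu => ?_
  · rw [Submodule.span_le, Set.singleton_subset_iff]
    refine ⟨by simp [kerSection], ?_⟩
    simp [kerSection]
    ring
  · obtain ⟨h2, h⟩ := hu
    rw [Submodule.mem_span_singleton]
    -- The coefficient is found by dividing by whichever of g₁, g₂ is nonzero at x.
    by_cases h1 : g₁.eval x.1 = 0
    · have h3 : g₂.eval x.1 ≠ 0 := fun h3 => hg ⟨h1, h3⟩
      have hu1 : u 1 = 0 := by simpa [h1, h3] using h
      refine ⟨-u 0 / g₂.eval x.1, ?_⟩
      ext i
      fin_cases i <;> simp [kerSection, h1, h2, h3, hu1]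
    · refine ⟨u 1 / g₁.eval x.1, ?_⟩
      ext i
      fin_cases i
      · simp [kerSection]
        field_simp
        linear_combination -h
      · simp [kerSection, h1]
      · simp [kerSection, h2]

/-- The subbundle `ker γ`. -/
noncomputable def kerBundle {n : ℕ} (hn : 4 ≤ n) (hg₁ : g₁.IsHomogeneous (n - 4))
    (hg₂ : g₂.IsHomogeneous (n - 3))
    (hg : ∀ x : Fin 2 → ℂ, x ≠ 0 → ¬(g₁.eval x = 0 ∧ g₂.eval x = 0)) : Subbundle weight :=
  Subbundle.ofFrame weight (r := 1) (fun _ => (4 - n : ℤ)) (fun _ => kerSection g₁ g₂)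
    (fun _ => differentiable_kerSection.differentiableOn)
    (fun x => LinearIndependent.of_subsingleton 0 (kerSection_ne_zero (hg x.1 x.2)))
    (fun t x _ => kerSection_scale hn hg₁ hg₂ t x.1)

theorem linearIndependent_frame {x : Fin 2 → ℂ} (hg : ¬(g₁.eval x = 0 ∧ g₂.eval x = 0)) :
    LinearIndependent ℂ fun j =>
      (![kerSection g₁ g₂, fun _ => Pi.single 2 1] : Fin 2 → (Fin 2 → ℂ) → Fin 3 → ℂ) j x := by
  rw [Fintype.linearIndependent_iff]
  intro c hc
  simp only [Fin.sum_univ_two] at hc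
  have h2 : c 1 = 0 := by simpa [kerSection] using congrFun hc 2
  have h0 : c 0 • kerSection g₁ g₂ x = 0 := by simpa [h2] using hc
  intro i
  fin_cases i
  · exact (smul_eq_zero.mp h0).resolve_right (kerSection_ne_zero hg)
  · exact h2

/-- The subbundle `ker γ ⊕ L`. -/
noncomputable def kerSumBundle {n : ℕ} (hn : 4 ≤ n) (hg₁ : g₁.IsHomogeneous (n - 4))
    (hg₂ : g₂.IsHomogeneous (n - 3))
    (hg : ∀ x : Fin 2 → ℂ, x ≠ 0 → ¬(g₁.eval x = 0 ∧ g₂.eval x = 0)) : Subbundle weight :=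
  Subbundle.ofFrame weight (r := 2) ![(4 - n : ℤ), -1]
    ![kerSection g₁ g₂, fun _ => Pi.single 2 1]
    (fun j => by
      fin_cases j
      · exact differentiable_kerSection.differentiableOn
      · exact differentiableOn_const _)
    (fun x => linearIndependent_frame (hg x.1 x.2))
    (fun t x j => by
      fin_cases j
      · exact kerSection_scale hn hg₁ hg₂ t x.1
      · have ht : (t : ℂ) ≠ 0 := t.ne_zero
        ext i
        fin_cases i <;> simp [weightAct_apply, weight, ht])

variable {n : ℕ} (hn : 4 ≤ n) (hg₁ : g₁.IsHomogeneous (n - 4)) (hg₂ : g₂.IsHomogeneous (n - 3))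
  (hg : ∀ x : Fin 2 → ℂ, x ≠ 0 → ¬(g₁.eval x = 0 ∧ g₂.eval x = 0))

theorem kerBundle_fibre (x : Cone) :
    (kerBundle hn hg₁ hg₂ hg).fibre x = kerGamma g₁ g₂ x := by
  rw [← span_kerSection (hg x.1 x.2), ← Set.range_const (ι := Fin 1)]
  rfl

theorem kerSumBundle_fibre (x : Cone) :
    (kerSumBundle hn hg₁ hg₂ hg).fibre x = kerGamma g₁ g₂ x ⊔ fibreL := by
  rw [← span_kerSection (hg x.1 x.2), fibreL, ← Submodule.span_union]
  change Submodule.span ℂ (Set.range fun j : Fin 2 =>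
    (![kerSection g₁ g₂, fun _ => Pi.single 2 1] : Fin 2 → (Fin 2 → ℂ) → Fin 3 → ℂ) j x.1) = _
  congr 1
  ext u
  simp

theorem kerBundle_hasDegree : (kerBundle hn hg₁ hg₂ hg).HasDegree (4 - n) := by
  have : (kerBundle hn hg₁ hg₂ hg).HasDegree (∑ _ : Fin 1, (4 - n : ℤ)) :=
    Subbundle.ofFrame_hasDegree _ _ _ _ _ _
  simpa using this

theorem kerSumBundle_hasDegree : (kerSumBundle hn hg₁ hg₂ hg).HasDegree (3 - n) := by
  have : (kerSumBundle hn hg₁ hg₂ hg).HasDegree (∑ j, (![(4 - n : ℤ), -1] : Fin 2 → ℤ) j) :=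
    Subbundle.ofFrame_hasDegree _ _ _ _ _ _
  convert this using 1
  simp
  ring

/-- Invariance in terms of `higgsMatrix`. -/
theorem invariant_iff {P : Finset CP1} (hP : P.card = n) (hq : q.IsHomogeneous 3)
    (F : Subbundle weight) : (nnoidHiggs hn hP hg₁ hg₂ hq).Invariant F ↔
      ∀ x : Cone, x.point ∉ P → ∀ u ∈ F.fibre x, (higgsMatrix g₁ g₂ q x.1).mulVec u ∈ F.fibre x := by
  have hform : ∀ (x : Cone) v u, (nnoidHiggs hn hP hg₁ hg₂ hq).form x v u =
      ((divisorForm P x.1)⁻¹ * area x.1 v) • (higgsMatrix g₁ g₂ q x.1).mulVec u := fun x v u => by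
    rw [← logFrame_apply]
    rfl
  constructor
  · intro h x hx u hu
    -- A non-radial tangent vector makes the scalar factor of the form invertible.
    obtain ⟨v, hv⟩ := exists_area_ne_zero x.2
    have := h x hx v u hu
    rw [hform] at this
    exact (Submodule.smul_mem_iff _
      (mul_ne_zero (inv_ne_zero (divisorForm_ne_zero hx)) hv)).mp this
  · intro h x hx v u hu
    rw [hform]
    exact Submodule.smul_mem _ _ (h x hx u hu)

theorem kerBundle_invariant {P : Finset CP1} (hP : P.card = n) (hq : q.IsHomogeneous 3) :
    (nnoidHiggs hn hP hg₁ hg₂ hq).Invariant (kerBundle hn hg₁ hg₂ hg) := by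
  rw [invariant_iff]
  intro x _ u hu
  rw [kerBundle_fibre] at hu
  obtain ⟨h2, h⟩ := hu
  rw [higgsMatrix_mulVec, h, h2]
  convert Submodule.zero_mem _
  ext i
  fin_cases i <;> simp

/-- Because γβ = 0, the Higgs matrix maps all of E into ker γ ⊕ L. -/
theorem kerSumBundle_invariant {P : Finset CP1} (hP : P.card = n) (hq : q.IsHomogeneous 3) :
    (nnoidHiggs hn hP hg₁ hg₂ hq).Invariant (kerSumBundle hn hg₁ hg₂ hg) := by
  rw [invariant_iff]
  intro x _ u _
  rw [kerSumBundle_fibre, mem_kerGamma_sup_fibreL, higgsMatrix_mulVec, gammaForm_apply]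
  simp
  ring

/-- The proper invariant subbundles are `ker γ` and `ker γ ⊕ L`. -/
theorem eq_or_eq_of_invariant {P : Finset CP1} (hP : P.card = n) (hq : q.IsHomogeneous 3)
    (hq0 : q ≠ 0) {F : Subbundle weight} (hF : F.IsProper)
    (hinv : (nnoidHiggs hn hP hg₁ hg₂ hq).Invariant F) :
    F = kerBundle hn hg₁ hg₂ hg ∨ F = kerSumBundle hn hg₁ hg₂ hg := by
  rw [invariant_iff] at hinv
  -- Off P invariance is available; off the zeros of q the pointwise linear algebra applies.
  have hp : divisorPoly P * q ≠ 0 := mul_ne_zero (divisorPoly_ne_zero P) hq0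
  have hgood : ∀ x : Cone, (divisorPoly P * q).eval x.1 ≠ 0 → q.eval x.1 ≠ 0 ∧
      ∀ u ∈ F.fibre x, (higgsMatrix g₁ g₂ q x.1).mulVec u ∈ F.fibre x := fun x hx => by
    rw [map_mul, eval_divisorPoly] at hx
    exact ⟨right_ne_zero_of_mul hx,
      hinv x (point_notMem_of_divisorForm_ne_zero (left_ne_zero_of_mul hx))⟩
  have hext : ∀ G : Subbundle weight, F.rank = G.rank → (∀ x, F.fibre x ≤ G.fibre x) → F = G :=
    fun G hr h => Subbundle.ext_fibre fun x => Submodule.eq_of_le_of_finrank_eq (h x) (by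
      rw [F.finrank_fibre, G.finrank_fibre, hr])
  obtain ⟨h0, h3⟩ := hF
  rw [Fintype.card_fin] at h3
  have hrank : F.rank = 1 ∨ F.rank = 2 := by omega
  rcases hrank with hr | hr
  · have hle : ∀ x : Cone, (divisorPoly P * q).eval x.1 ≠ 0 → F.fibre x ≤ kerGamma g₁ g₂ x :=
      fun x hx => le_kerGamma_of_finrank_eq_one (hg x.1 x.2) (hgood x hx).1 (hgood x hx).2
        (by rw [F.finrank_fibre, hr])
    refine Or.inl (hext _ hr fun x u hu => ?_)
    rw [kerBundle_fibre, mem_kerGamma]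
    -- The line ker γ ⊂ V is cut out by two equations, u₂ = 0 and γ(u) = 0, each extended
    -- separately.
    exact ⟨F.fibre_equation hp (fun _ => LinearMap.proj 2) (by simp; fun_prop)
        (fun y hy w hw => (hle y hy hw).1) x u hu,
      F.fibre_equation hp _ continuous_gammaForm (fun y hy w hw => (hle y hy hw).2) x u hu⟩
  · refine Or.inr (hext _ hr fun x u hu => ?_)
    rw [kerSumBundle_fibre, mem_kerGamma_sup_fibreL]
    exact F.fibre_equation hp _ continuous_gammaForm (fun y hy w hw =>
      gammaForm_eq_zero_of_finrank_eq_two (hgood y hy).1 (hgood y hy).2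
        (by rw [F.finrank_fibre, hr]) hw) x u hu

end Kernel

/-! ### Slopes and stability -/

theorem totalDegree_weight : totalDegree weight = 0 := by
  simp [totalDegree, weight, Fin.sum_univ_three]

theorem totalSlope_weight : totalSlope weight = 0 := by
  simp [totalSlope, totalDegree_weight]

end NNoid

theorem mainTheorem7 (n : ℕ) (hn : 4 ≤ n)
    (P : Finset NNoid.CP1) (hP : P.card = n)
    (g₁ g₂ q : MvPolynomial (Fin 2) ℂ)
    (hg₁ : g₁.IsHomogeneous (n - 4)) (hg₂ : g₂.IsHomogeneous (n - 3)) (hq : q.IsHomogeneous 3)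
    (hqP : ∀ p ∈ P, q.eval p.rep ≠ 0)
    (hg : ∀ x : Fin 2 → ℂ, x ≠ 0 → ¬ (g₁.eval x = 0 ∧ g₂.eval x = 0)) :
    ∃ F₁ F₂ : NNoid.Subbundle NNoid.weight,
      (∀ x, F₁.fibre x = NNoid.kerGamma g₁ g₂ x) ∧
      (∀ x, F₂.fibre x = NNoid.kerGamma g₁ g₂ x ⊔ NNoid.fibreL) ∧
      (∀ F : NNoid.Subbundle NNoid.weight,
        F.IsProper ∧ (NNoid.nnoidHiggs hn hP hg₁ hg₂ hq).Invariant F ↔ F = F₁ ∨ F = F₂) ∧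
      F₁.HasDegree (4 - n) ∧ F₁.degree = 4 - n ∧
      F₂.HasDegree (3 - n) ∧ F₂.degree = 3 - n ∧
      NNoid.totalDegree NNoid.weight = 0 ∧
      (5 ≤ n → (NNoid.nnoidHiggs hn hP hg₁ hg₂ hq).IsStable) ∧
      (n = 4 → (NNoid.nnoidHiggs hn hP hg₁ hg₂ hq).IsStrictlySemistable) := by
  -- P is nonempty, so nonvanishing of q on P makes q a nonzero polynomial; its zeros elsewhere are
  -- absorbed by density.
  have hq0 : q ≠ 0 := by
    obtain ⟨p, hp⟩ := Finset.card_pos.mp (by omega : 0 < P.card)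
    rintro rfl
    exact hqP p hp (map_zero _)
  set F₁ := NNoid.kerBundle hn hg₁ hg₂ hg with hF₁
  set F₂ := NNoid.kerSumBundle hn hg₁ hg₂ hg with hF₂
  have d₁ : F₁.HasDegree (4 - n) := NNoid.kerBundle_hasDegree hn hg₁ hg₂ hg
  have d₂ : F₂.HasDegree (3 - n) := NNoid.kerSumBundle_hasDegree hn hg₁ hg₂ hg
  have p₁ : F₁.IsProper := ⟨Nat.one_pos, show 1 < Fintype.card (Fin 3) by simp⟩
  have p₂ : F₂.IsProper := ⟨Nat.two_pos, show 2 < Fintype.card (Fin 3) by simp⟩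
  have i₁ := NNoid.kerBundle_invariant hn hg₁ hg₂ hg hP hq
  have i₂ := NNoid.kerSumBundle_invariant hn hg₁ hg₂ hg hP hq
  have s₁ : F₁.slope = 4 - n := by
    have hr : F₁.rank = 1 := rfl
    rw [NNoid.Subbundle.slope, d₁.degree_eq, hr]
    simp
  have s₂ : F₂.slope = (3 - n) / 2 := by
    have hr : F₂.rank = 2 := rfl
    rw [NNoid.Subbundle.slope, d₂.degree_eq, hr]
    simp
  have hclass : ∀ F : NNoid.Subbundle NNoid.weight, F.IsProper →
      (NNoid.nnoidHiggs hn hP hg₁ hg₂ hq).Invariant F → F = F₁ ∨ F = F₂ := fun F h h' =>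
    NNoid.eq_or_eq_of_invariant hn hg₁ hg₂ hg hP hq hq0 h h'
  refine ⟨F₁, F₂, NNoid.kerBundle_fibre hn hg₁ hg₂ hg, NNoid.kerSumBundle_fibre hn hg₁ hg₂ hg,
    fun F => ⟨fun h => hclass F h.1 h.2, ?_⟩, d₁, d₁.degree_eq, d₂, d₂.degree_eq,
    NNoid.totalDegree_weight, fun h5 F hF hF' => ?_, ?_⟩
  · rintro (rfl | rfl)
    exacts [⟨p₁, i₁⟩, ⟨p₂, i₂⟩]
  · have h5 : (5 : ℚ) ≤ n := by exact_mod_cast h5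
    rw [NNoid.totalSlope_weight]
    rcases hclass F hF hF' with h | h <;> subst h
    · rw [s₁]; linarith
    · rw [s₂]; linarith
  · intro h4
    have h4 : (n : ℚ) = 4 := by exact_mod_cast h4
    refine ⟨fun F hF hF' => ?_, fun h => ?_⟩
    · rw [NNoid.totalSlope_weight]
      rcases hclass F hF hF' with h | h <;> subst h
      · rw [s₁]; linarith
      · rw [s₂]; linarith
    -- For n = 4 the slope of ker γ is 0, the slope of E, so the strict inequality fails.
    · have := h F₁ p₁ i₁
      rw [NNoid.totalSlope_weight, s₁] at this
      linarith
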